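/- **Theorem (product expansion of $\Delta$).** Let $\mathcal H=\{\tau\in\mathbb C:\operatorname{Im}\tau>0\}$, write $q=e^{2\pi i\tau}$ for $\tau\in\mathcal H$, and let $S_{12}(\Gamma)$ be the complex vector space of cusp forms of weight $12$ for $\Gamma=\mathrm{SL}_2(\mathbb Z)$. There is exactly one $\Delta\in S_{12}(\Gamma)$ such that every element of $S_{12}(\Gamma)$ is a complex multiple of $\Delta$ and the coefficient of $q^1$ in the Fourier expansion of $\Delta$ is $1$ (Ramanujan's Delta function). For every $\tau\in\mathcal H$ the infinite product below converges, and $$\Delta(\tau)=q\prod_{n\ge1}(1-q^n)^{24}.$$ -/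

import Mathlib

open scoped MatrixGroups

/-- `Δ` is the normalized generator of the space `S₁₂(SL₂(ℤ))` of cusp forms of weight 12 and
level one: every such cusp form is a multiple of `Δ`, and the coefficient of `q¹` in the Fourier
expansion of `Δ` (in powers of `q = exp(2πiτ)`) is `1`. -/
def IsRamanujanDelta (Δ : CuspForm 𝒮ℒ 12) : Prop :=
  (∀ f : CuspForm 𝒮ℒ 12, ∃ c : ℂ, f = c • Δ) ∧
    (UpperHalfPlane.qExpansion 1 Δ).coeff 1 = 1

/-- The variable `q = exp(2πiτ)`, for `τ` in the upper half-plane. -/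
noncomputable def nome (τ : UpperHalfPlane) : ℂ :=
  Complex.exp (2 * (Real.pi : ℂ) * Complex.I * (τ : ℂ))

/-! The space of weight 12 cusp forms is the line spanned by `CuspForm.discriminant`, whose
`q`-coefficient is 1. The normalization thus leaves only this form, and its product formula
`ModularForm.discriminant_eq_q_prod` carries over. -/

/-- Mathlib's modular discriminant is a normalized generator of `S₁₂(SL₂(ℤ))`. -/
theorem isRamanujanDelta_discriminant : IsRamanujanDelta CuspForm.discriminant :=
  ⟨fun f => (CuspForm.exists_smul_discriminant_of_weight_eq_twelve f).imp fun _ h => h.symm,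
    ModularForm.discriminant_qExpansion_coeff_one⟩

/-- A normalized cusp form of weight 12 and level one is the modular discriminant. -/
theorem IsRamanujanDelta.eq_discriminant {Δ : CuspForm 𝒮ℒ 12} (h : IsRamanujanDelta Δ) :
    Δ = CuspForm.discriminant := by
  obtain ⟨c, rfl⟩ := CuspForm.exists_smul_discriminant_of_weight_eq_twelve Δ
  have hc := h.2
  -- By linearity the `q`-coefficient of `c • CuspForm.discriminant` is `c`, so `hc` becomes `c =
  -- 1`.
  rw [show (⇑(c • CuspForm.discriminant) : UpperHalfPlane → ℂ) = c • ⇑CuspForm.discriminant from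
      rfl, ModularForm.qExpansion_smul one_pos one_mem_strictPeriods_SL c CuspForm.discriminant,
    PowerSeries.coeff_smul, CuspForm.coe_discriminant,
    ModularForm.discriminant_qExpansion_coeff_one, smul_eq_mul, mul_one] at hc
  rw [hc, one_smul]

theorem nome_eq_qParam (τ : UpperHalfPlane) : nome τ = Function.Periodic.qParam 1 τ := by
  simp [nome, Function.Periodic.qParam]

/-- Needed for convergence of the product. -/
theorem norm_nome_lt_one (τ : UpperHalfPlane) : ‖nome τ‖ < 1 := by
  simpa [nome] using UpperHalfPlane.norm_exp_two_pi_I_lt_one τ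

theorem mainTheorem4 :
    (∃! Δ : CuspForm 𝒮ℒ 12, IsRamanujanDelta Δ) ∧
    ∀ Δ : CuspForm 𝒮ℒ 12, IsRamanujanDelta Δ →
      ∀ τ : UpperHalfPlane,
        Multipliable (fun n : ℕ => (1 - nome τ ^ (n + 1)) ^ 24) ∧
        Δ τ = nome τ * ∏' n : ℕ, (1 - nome τ ^ (n + 1)) ^ 24 := by
  refine ⟨⟨CuspForm.discriminant, isRamanujanDelta_discriminant, fun Δ h => h.eq_discriminant⟩,
    fun Δ h τ => ⟨(ModularForm.multipliable_one_sub_pow (norm_nome_lt_one τ)).pow 24, ?_⟩⟩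
  rw [h.eq_discriminant, nome_eq_qParam]
  exact ModularForm.discriminant_eq_q_prod τ
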